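/- Let $0<q<1$ and let each of $Y_1,Y_2$ be one of two quantum spaces $\widetilde X$ (quantum principal homogeneous space) or $\widetilde\Xi$ (quantum cone), defined as follows. $\mathrm{Pol}(Y)_q$ is the unital $\mathbb C$-algebra with generators $t_{11},t_{12},t_{21},t_{22}$ and relations $t_{11}t_{12}=qt_{12}t_{11}$, $t_{21}t_{22}=qt_{22}t_{21}$, $t_{11}t_{21}=qt_{21}t_{11}$, $t_{12}t_{22}=qt_{22}t_{12}$, $t_{12}t_{21}=t_{21}t_{12}$, $t_{11}t_{22}-t_{22}t_{11}=(q-q^{-1})t_{12}t_{21}$, and $t_{11}t_{22}-qt_{12}t_{21}=1$ for $Y=\widetilde X$, resp. $t_{11}t_{22}-qt_{12}t_{21}=0$ for $Y=\widetilde\Xi$, with the involution $t_{11}^*=-t_{22}$, $t_{12}^*=-qt_{21}$. Put $x=t_{12}t_{12}^*$. The space of distributions $D(Y)_q'\supset \mathrm{Pol}(Y)_q$ is the space of formal series $$f=\sum_{i_1j_1=i_2j_2=0}t_{11}^{i_1}t_{12}^{i_2}\,\psi_{i_1i_2j_1j_2}(x)\,t_{12}^{*j_2}t_{11}^{*j_1}\qquad(i_1,i_2,j_1,j_2\in\mathbb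 Z_{\ge0})$$ whose coefficients are arbitrary complex functions on $q^{-2\mathbb Z_{\ge 0}}$ (for $\widetilde X$), resp. on $q^{2\mathbb Z}$ (for $\widetilde\Xi$), with the topology of pointwise convergence of the coefficients. The space $D(Y)_q$ of finite functions consists of the $f$ for which only finitely many values of the coefficients are nonzero. The involution of $D(Y)'_q$ and the product $D(Y)_q'\times D(Y)_q\to D(Y)_q'$ are transferred by continuity from $\mathrm{Pol}(Y)_q$, and $$\int_{Y_q} f\,d\nu=(1-q^2)\sum_{m}\psi_{0000}(q^{-2m})\,q^{-2m},$$ where $m$ runs over $\mathbb Z_{\ge0}$ for $\widetilde X$ and over $\mathbb Z$ for $\widetilde\Xi$; this is used for those $f$ for which $\psi_{0000}$ has finite support. Let $D(Y_1\times Y_2)_q'$ be the corresponding completion of $\mathrm{Pol}(Y_1\times Y_2)_q=\mathrm{Pol}(Y_1)_q^{\rm op}\otimes\mathrm{Pol}(Y_2)_q$, that is, the space of formal series in tensor products of the above monomials whose coefficients are arbitrary functions of two variables on the product of the two progressions. For $K\in D(Y_1\times Y_2)'_q$ and $f\in D(Y_2)_q$ let $\int_{Y_{2q}}\{K\cdot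 1\otimes f\}\,d\nu_2\in D(Y_1)'_q$ be the partial integral in the second factor. Then there is a unique antilinear map $\#:D(Y_1\times Y_2)_q'\to D(Y_1\times Y_2)_q'$ such that for all $K\in D(Y_1\times Y_2)_q'$ and $f\in D(Y_2)_q$ $$\int_{Y_{2q}}\{K^\#\cdot 1\otimes f\}\,d\nu_2=\Bigl(\int_{Y_{2q}}\{K\cdot 1\otimes f^*\}\,d\nu_2\Bigr)^*,$$ and, writing $t_{ij}$ for the kernel $t_{ij}\otimes1$ and $\tau_{ij}$ for the kernel $1\otimes t_{ij}$, it satisfies $$t_{11}^\#=-t_{22},\qquad t_{21}^\#=-q^{-1}t_{12},\qquad \tau_{11}^\#=-q^{-2}\tau_{22},\qquad \tau_{21}^\#=-q^{-1}\tau_{12}.$$ -/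

import Mathlib

open scoped TensorProduct

noncomputable section

namespace QKernel

/-- The quantum principal homogeneous space `X` (written `X` with a tilde in print) and its
asymptotic quantum cone `Xi`. -/
inductive Space
  | X
  | Xi

/-- The parameter `q`, `0 < q < 1`, as a complex number. -/
def cq (q : Set.Ioo (0 : ℝ) 1) : ℂ := ((q : ℝ) : ℂ)

/-- The four generators `t₁₁, t₁₂, t₂₁, t₂₂`. -/
inductive Gen
  | t11
  | t12
  | t21
  | t22

/-- The right hand side of the "determinant" relation `t₁₁ t₂₂ - q t₁₂ t₂₁ = 1` for `X` and
`t₁₁ t₂₂ - q t₁₂ t₂₁ = 0` for the cone. -/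
def detVal : Space → ℂ
  | .X => 1
  | .Xi => 0

/-- The defining relations of the algebra of polynomials on `X` (that is, of `ℂ[SL₂]_q`) and on the
cone. -/
inductive Rel (q : Set.Ioo (0 : ℝ) 1) (Y : Space) :
    FreeAlgebra ℂ Gen → FreeAlgebra ℂ Gen → Prop
  | r1 : Rel q Y (FreeAlgebra.ι ℂ Gen.t11 * FreeAlgebra.ι ℂ Gen.t12)
      (cq q • (FreeAlgebra.ι ℂ Gen.t12 * FreeAlgebra.ι ℂ Gen.t11))
  | r2 : Rel q Y (FreeAlgebra.ι ℂ Gen.t21 * FreeAlgebra.ι ℂ Gen.t22)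
      (cq q • (FreeAlgebra.ι ℂ Gen.t22 * FreeAlgebra.ι ℂ Gen.t21))
  | r3 : Rel q Y (FreeAlgebra.ι ℂ Gen.t11 * FreeAlgebra.ι ℂ Gen.t21)
      (cq q • (FreeAlgebra.ι ℂ Gen.t21 * FreeAlgebra.ι ℂ Gen.t11))
  | r4 : Rel q Y (FreeAlgebra.ι ℂ Gen.t12 * FreeAlgebra.ι ℂ Gen.t22)
      (cq q • (FreeAlgebra.ι ℂ Gen.t22 * FreeAlgebra.ι ℂ Gen.t12))
  | r5 : Rel q Y (FreeAlgebra.ι ℂ Gen.t12 * FreeAlgebra.ι ℂ Gen.t21)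
      (FreeAlgebra.ι ℂ Gen.t21 * FreeAlgebra.ι ℂ Gen.t12)
  | r6 : Rel q Y (FreeAlgebra.ι ℂ Gen.t11 * FreeAlgebra.ι ℂ Gen.t22
        - FreeAlgebra.ι ℂ Gen.t22 * FreeAlgebra.ι ℂ Gen.t11)
      ((cq q - (cq q)⁻¹) • (FreeAlgebra.ι ℂ Gen.t12 * FreeAlgebra.ι ℂ Gen.t21))
  | r7 : Rel q Y (FreeAlgebra.ι ℂ Gen.t11 * FreeAlgebra.ι ℂ Gen.t22
        - cq q • (FreeAlgebra.ι ℂ Gen.t12 * FreeAlgebra.ι ℂ Gen.t21))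
      (algebraMap ℂ (FreeAlgebra ℂ Gen) (detVal Y))

/-- The algebra `Pol(Y)_q`, by generators and relations. -/
abbrev Pol (q : Set.Ioo (0 : ℝ) 1) (Y : Space) : Type := RingQuot (Rel q Y)

/-- The generators of `Pol(Y)_q`. -/
def gen (q : Set.Ioo (0 : ℝ) 1) (Y : Space) (g : Gen) : Pol q Y :=
  RingQuot.mkAlgHom ℂ (Rel q Y) (FreeAlgebra.ι ℂ g)

/-- The element `t₁₁^* = -t₂₂` of `Pol(Y)_q`. -/
def t11s (q : Set.Ioo (0 : ℝ) 1) (Y : Space) : Pol q Y := -gen q Y .t22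

/-- The element `t₁₂^* = -q t₂₁` of `Pol(Y)_q`. -/
def t12s (q : Set.Ioo (0 : ℝ) 1) (Y : Space) : Pol q Y := -(cq q • gen q Y .t21)

/-- The geometric progression on which the coefficients live: `m ∈ Grid Y` stands for the point
`x = q^(-2m)`, where `m = 0, 1, 2, …` for `X` and `m` is an arbitrary integer for the cone. -/
def Grid : Space → Set ℤ
  | .X => Set.Ici 0
  | .Xi => Set.univ

/-- Indices `((a, b), m)`. The pair `(a, b) ∈ ℤ²` encodes the quadruple `(i₁, i₂, j₁, j₂)` of
nonnegative integers with `i₁ j₁ = i₂ j₂ = 0` through `a = i₁ - j₁`, `b = i₂ - j₂`,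
that is, `i₁ = a.toNat`, `j₁ = (-a).toNat`, `i₂ = b.toNat`, `j₂ = (-b).toNat`. -/
abbrev Idx (Y : Space) : Type := (ℤ × ℤ) × Grid Y

/-- The space `D(Y)'_q` of distributions: formal series
`∑ t₁₁^i₁ t₁₂^i₂ ψ_{i₁ i₂ j₁ j₂}(x) t₁₂^{* j₂} t₁₁^{* j₁}`, `x = t₁₂ t₁₂^*`, whose coefficients
are arbitrary functions on the progression. The value of `F` at `((a, b), m)` is
`ψ_{i₁ i₂ j₁ j₂}(q^(-2m))`. -/
abbrev Dist (Y : Space) : Type := Idx Y → ℂ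

/-- A finite function on `Y`: only finitely many values of the coefficients are nonzero. -/
def IsFin {Y : Space} (f : Dist Y) : Prop := (Function.support f).Finite

/-- The coefficient `ψ_{ab}` of `F` at `x = q^(-2m)`, continued by zero off the progression. -/
def val {Y : Space} (F : Dist Y) (a b m : ℤ) : ℂ :=
  open Classical in if h : m ∈ Grid Y then F ((a, b), ⟨m, h⟩) else 0

lemma cq_ne_zero (q : Set.Ioo (0 : ℝ) 1) : cq q ≠ 0 := by
  simpa [cq] using q.2.1.ne'

/-- Left multiplication by `t₁₁`. It uses
`t₁₁ t₁₂ = q t₁₂ t₁₁`, `t₁₁ t₁₂^* = q t₁₂^* t₁₁`, `t₁₁ ψ(x) = ψ(q² x) t₁₁` and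
`t₁₁ t₁₁^* = x - detVal Y`. -/
def A11 (q : Set.Ioo (0 : ℝ) 1) (Y : Space) : Module.End ℂ (Dist Y) where
  toFun F := fun ((a, b), m) =>
    if 0 < a then val F (a - 1) b m
    else cq q ^ |b| * (cq q ^ (-2 * (m : ℤ)) - detVal Y) * val F (a - 1) b (m - 1)
  map_add' F G := by
    ext ⟨⟨a, b⟩, m⟩
    simp only [val, Pi.add_apply]
    split_ifs <;> ring
  map_smul' c F := by
    ext ⟨⟨a, b⟩, m⟩
    simp only [val, Pi.smul_apply, smul_eq_mul, RingHom.id_apply]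
    split_ifs <;> ring

/-- Left multiplication by `t₁₁^*`. It uses
`t₁₁^* t₁₁ = q⁻² x - detVal Y`, `x t₁₁ = q⁻² t₁₁ x`, `t₁₁^* t₁₂ = q⁻¹ t₁₂ t₁₁^*`,
`t₁₁^* t₁₂^* = q⁻¹ t₁₂^* t₁₁^*` and `t₁₁^* ψ(x) = ψ(q⁻² x) t₁₁^*`. -/
def A11s (q : Set.Ioo (0 : ℝ) 1) (Y : Space) : Module.End ℂ (Dist Y) where
  toFun F := fun ((a, b), m) =>
    if 0 ≤ a then (cq q ^ (-2 * (a + 1 + m)) - detVal Y) * val F (a + 1) b m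
    else cq q ^ (-|b|) * val F (a + 1) b (m + 1)
  map_add' F G := by
    ext ⟨⟨a, b⟩, m⟩
    simp only [val, Pi.add_apply]
    split_ifs <;> ring
  map_smul' c F := by
    ext ⟨⟨a, b⟩, m⟩
    simp only [val, Pi.smul_apply, smul_eq_mul, RingHom.id_apply]
    split_ifs <;> ring

/-- Left multiplication by `t₁₂`. It uses `t₁₂ t₁₁ = q⁻¹ t₁₁ t₁₂` and `t₁₂ t₁₂^* = x`. -/
def A12 (q : Set.Ioo (0 : ℝ) 1) (Y : Space) : Module.End ℂ (Dist Y) where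
  toFun F := fun ((a, b), m) =>
    cq q ^ (-max a 0) * (if 0 < b then 1 else cq q ^ (-2 * (m : ℤ))) * val F a (b - 1) m
  map_add' F G := by
    ext ⟨⟨a, b⟩, m⟩
    simp only [val, Pi.add_apply]
    split_ifs <;> ring
  map_smul' c F := by
    ext ⟨⟨a, b⟩, m⟩
    simp only [val, Pi.smul_apply, smul_eq_mul, RingHom.id_apply]
    split_ifs <;> ring

/-- Left multiplication by `t₁₂^*`. It uses `t₁₂^* t₁₁ = q⁻¹ t₁₁ t₁₂^*` and
`t₁₂^* t₁₂ = x`. -/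
def A12s (q : Set.Ioo (0 : ℝ) 1) (Y : Space) : Module.End ℂ (Dist Y) where
  toFun F := fun ((a, b), m) =>
    cq q ^ (-max a 0) * (if b < 0 then 1 else cq q ^ (-2 * (m : ℤ))) * val F a (b + 1) m
  map_add' F G := by
    ext ⟨⟨a, b⟩, m⟩
    simp only [val, Pi.add_apply]
    split_ifs <;> ring
  map_smul' c F := by
    ext ⟨⟨a, b⟩, m⟩
    simp only [val, Pi.smul_apply, smul_eq_mul, RingHom.id_apply]
    split_ifs <;> ring

/-- Left multiplication by `ψ(x)`, `ψ` a function on the progression. It uses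
`ψ(x) t₁₁^i = t₁₁^i ψ(q^(-2i) x)`. -/
def Afun {Y : Space} (ψ : Grid Y → ℂ) : Module.End ℂ (Dist Y) where
  toFun F := fun ((a, b), m) =>
    (open Classical in if h : (m : ℤ) + max a 0 ∈ Grid Y then ψ ⟨m + max a 0, h⟩ else 0)
      * F ((a, b), m)
  map_add' F G := by
    ext ⟨⟨a, b⟩, m⟩
    simp only [Pi.add_apply]
    ring
  map_smul' c F := by
    ext ⟨⟨a, b⟩, m⟩
    simp only [Pi.smul_apply, smul_eq_mul, RingHom.id_apply]
    ring

/-- Left multiplication by the generators, with `t₂₁ = -q⁻¹ t₁₂^*`, `t₂₂ = -t₁₁^*`. -/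
def genAct (q : Set.Ioo (0 : ℝ) 1) (Y : Space) : Gen → Module.End ℂ (Dist Y)
  | .t11 => A11 q Y
  | .t12 => A12 q Y
  | .t21 => -((cq q)⁻¹ • A12s q Y)
  | .t22 => -A11s q Y

lemma grid_add_one {Y : Space} {m : ℤ} (h : m ∈ Grid Y) : m + 1 ∈ Grid Y := by
  cases Y <;> simp_all [Grid]; omega

lemma grid_sub_one {Y : Space} {m : ℤ} (q : Set.Ioo (0 : ℝ) 1) (h : m ∈ Grid Y)
    (h' : m - 1 ∉ Grid Y) : cq q ^ (-2 * m) - detVal Y = 0 := by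
  cases Y
  · simp only [Grid, Set.mem_Ici] at h h'
    obtain rfl : m = 0 := by omega
    simp [detVal]
  · simp [Grid] at h'

lemma A11_apply (q : Set.Ioo (0 : ℝ) 1) {Y : Space} (F : Dist Y) (a b : ℤ) (m : Grid Y) :
    A11 q Y F ((a, b), m) = if 0 < a then val F (a - 1) b m
      else cq q ^ |b| * (cq q ^ (-2 * (m : ℤ)) - detVal Y) * val F (a - 1) b (m - 1) := rfl

lemma A11s_apply (q : Set.Ioo (0 : ℝ) 1) {Y : Space} (F : Dist Y) (a b : ℤ) (m : Grid Y) :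
    A11s q Y F ((a, b), m) =
      if 0 ≤ a then (cq q ^ (-2 * (a + 1 + m)) - detVal Y) * val F (a + 1) b m
      else cq q ^ (-|b|) * val F (a + 1) b (m + 1) := rfl

lemma A12_apply (q : Set.Ioo (0 : ℝ) 1) {Y : Space} (F : Dist Y) (a b : ℤ) (m : Grid Y) :
    A12 q Y F ((a, b), m) = cq q ^ (-max a 0) *
      (if 0 < b then 1 else cq q ^ (-2 * (m : ℤ))) * val F a (b - 1) m := rfl

lemma A12s_apply (q : Set.Ioo (0 : ℝ) 1) {Y : Space} (F : Dist Y) (a b : ℤ) (m : Grid Y) :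
    A12s q Y F ((a, b), m) = cq q ^ (-max a 0) *
      (if b < 0 then 1 else cq q ^ (-2 * (m : ℤ))) * val F a (b + 1) m := rfl

lemma val_mem {Y : Space} (F : Dist Y) (a b : ℤ) {m : ℤ} (h : m ∈ Grid Y) :
    val F a b m = F ((a, b), ⟨m, h⟩) := by simp [val, h]

lemma val_notMem {Y : Space} (F : Dist Y) (a b : ℤ) {m : ℤ} (h : m ∉ Grid Y) :
    val F a b m = 0 := by simp [val, h]

lemma rel_11_12 (q : Set.Ioo (0 : ℝ) 1) (Y : Space) :
    A11 q Y * A12 q Y = cq q • (A12 q Y * A11 q Y) := by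
  have hq := cq_ne_zero q
  ext F ⟨⟨a, b⟩, ⟨m, hm⟩⟩
  simp only [Module.End.mul_apply, LinearMap.smul_apply, Pi.smul_apply, smul_eq_mul]
  rcases lt_or_ge 0 a with ha | ha
  · simp only [A11_apply, A12_apply, val_mem, hm, ha, if_true, max_eq_left ha.le,
      max_eq_left (show (0 : ℤ) ≤ a - 1 by omega)]
    rw [show -a = -(a - 1) - 1 by ring, zpow_sub_one₀ hq]
    field_simp
  · by_cases hm' : m - 1 ∈ Grid Y
    · simp only [A11_apply, A12_apply, val_mem, hm, hm', ha.not_gt, if_false, max_eq_right ha,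
        max_eq_right (show a - 1 ≤ 0 by omega), neg_zero, zpow_zero, one_mul]
      rw [show -2 * (m - 1) = -2 * m + 2 by ring, zpow_add₀ hq]
      rcases lt_or_ge 0 b with hb | hb
      · rw [if_pos hb, if_pos hb, abs_of_pos hb, abs_of_nonneg (show (0 : ℤ) ≤ b - 1 by omega),
          zpow_sub_one₀ hq]
        field_simp
      · rw [if_neg hb.not_gt, if_neg hb.not_gt, abs_of_nonpos hb,
          abs_of_nonpos (show b - 1 ≤ 0 by omega), show -(b - 1) = -b + 1 by ring,
          zpow_add_one₀ hq]
        simp only [zpow_ofNat]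
        ring
    · simp [A11_apply, A12_apply, val_mem, val_notMem, hm, hm', ha.not_gt]

lemma rel_11_12s (q : Set.Ioo (0 : ℝ) 1) (Y : Space) :
    A11 q Y * A12s q Y = cq q • (A12s q Y * A11 q Y) := by
  have hq := cq_ne_zero q
  ext F ⟨⟨a, b⟩, ⟨m, hm⟩⟩
  simp only [Module.End.mul_apply, LinearMap.smul_apply, Pi.smul_apply, smul_eq_mul]
  rcases lt_or_ge 0 a with ha | ha
  · simp only [A11_apply, A12s_apply, val_mem, hm, ha, if_true, max_eq_left ha.le,
      max_eq_left (show (0 : ℤ) ≤ a - 1 by omega)]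
    rw [show -a = -(a - 1) - 1 by ring, zpow_sub_one₀ hq]
    field_simp
  · by_cases hm' : m - 1 ∈ Grid Y
    · simp only [A11_apply, A12s_apply, val_mem, hm, hm', ha.not_gt, if_false, max_eq_right ha,
        max_eq_right (show a - 1 ≤ 0 by omega), neg_zero, zpow_zero, one_mul]
      rw [show -2 * (m - 1) = -2 * m + 2 by ring, zpow_add₀ hq]
      rcases lt_or_ge b 0 with hb | hb
      · rw [if_pos hb, if_pos hb, abs_of_neg hb, abs_of_nonpos (show b + 1 ≤ 0 by omega),
          show -b = -(b + 1) + 1 by ring, zpow_add_one₀ hq]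
        ring
      · rw [if_neg hb.not_gt, if_neg hb.not_gt, abs_of_nonneg hb,
          abs_of_nonneg (show 0 ≤ b + 1 by omega), zpow_add_one₀ hq]
        simp only [zpow_ofNat]
        ring
    · simp [A11_apply, A12s_apply, val_mem, val_notMem, hm, hm', ha.not_gt]

lemma rel_12_11s (q : Set.Ioo (0 : ℝ) 1) (Y : Space) :
    A12 q Y * A11s q Y = cq q • (A11s q Y * A12 q Y) := by
  have hq := cq_ne_zero q
  ext F ⟨⟨a, b⟩, ⟨m, hm⟩⟩
  have hm' := grid_add_one hm
  simp only [Module.End.mul_apply, LinearMap.smul_apply, Pi.smul_apply, smul_eq_mul]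
  rcases le_or_gt 0 a with ha | ha
  · simp only [A11s_apply, A12_apply, val_mem, hm, ha, if_true, max_eq_left ha,
      max_eq_left (show (0 : ℤ) ≤ a + 1 by omega)]
    rw [show -(a + 1) = -a - 1 by ring, zpow_sub_one₀ hq]
    field_simp
  · simp only [A11s_apply, A12_apply, val_mem, hm, hm', ha.not_ge, if_false, max_eq_right ha.le,
      max_eq_right (show a + 1 ≤ 0 by omega), neg_zero, zpow_zero, one_mul]
    rw [show -2 * (m + 1) = -2 * m - 1 - 1 by ring, zpow_sub_one₀ hq, zpow_sub_one₀ hq]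
    rcases lt_or_ge 0 b with hb | hb
    · rw [if_pos hb, if_pos hb, abs_of_pos hb, abs_of_nonneg (show (0 : ℤ) ≤ b - 1 by omega),
        show -b = -(b - 1) - 1 by ring, zpow_sub_one₀ hq]
      field_simp
    · rw [if_neg hb.not_gt, if_neg hb.not_gt, abs_of_nonpos hb,
        abs_of_nonpos (show b - 1 ≤ 0 by omega), neg_neg, neg_neg, zpow_sub_one₀ hq]
      field_simp

lemma rel_12s_11s (q : Set.Ioo (0 : ℝ) 1) (Y : Space) :
    A12s q Y * A11s q Y = cq q • (A11s q Y * A12s q Y) := by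
  have hq := cq_ne_zero q
  ext F ⟨⟨a, b⟩, ⟨m, hm⟩⟩
  have hm' := grid_add_one hm
  simp only [Module.End.mul_apply, LinearMap.smul_apply, Pi.smul_apply, smul_eq_mul]
  rcases le_or_gt 0 a with ha | ha
  · simp only [A11s_apply, A12s_apply, val_mem, hm, ha, if_true, max_eq_left ha,
      max_eq_left (show (0 : ℤ) ≤ a + 1 by omega)]
    rw [show -(a + 1) = -a - 1 by ring, zpow_sub_one₀ hq]
    field_simp
  · simp only [A11s_apply, A12s_apply, val_mem, hm, hm', ha.not_ge, if_false, max_eq_right ha.le,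
      max_eq_right (show a + 1 ≤ 0 by omega), neg_zero, zpow_zero, one_mul]
    rw [show -2 * (m + 1) = -2 * m - 1 - 1 by ring, zpow_sub_one₀ hq, zpow_sub_one₀ hq]
    rcases lt_or_ge b 0 with hb | hb
    · rw [if_pos hb, if_pos hb, abs_of_neg hb, abs_of_nonpos (show b + 1 ≤ 0 by omega),
        neg_neg, neg_neg, zpow_add_one₀ hq]
      field_simp
    · rw [if_neg hb.not_gt, if_neg hb.not_gt, abs_of_nonneg hb,
        abs_of_nonneg (show 0 ≤ b + 1 by omega), show -(b + 1) = -b - 1 by ring,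
        zpow_sub_one₀ hq]
      field_simp

lemma A12_A12s_apply (q : Set.Ioo (0 : ℝ) 1) {Y : Space} (F : Dist Y) (a b : ℤ) (m : Grid Y) :
    (A12 q Y * A12s q Y) F ((a, b), m) = cq q ^ (-2 * (max a 0 + m)) * F ((a, b), m) := by
  have hq := cq_ne_zero q
  obtain ⟨m, hm⟩ := m
  simp only [Module.End.mul_apply, A12s_apply, A12_apply, val_mem, hm, sub_add_cancel]
  rw [show -2 * (max a 0 + m) = -max a 0 + -max a 0 + -2 * m by ring, zpow_add₀ hq, zpow_add₀ hq]
  rcases lt_or_ge 0 b with hb | hb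
  · rw [if_pos hb, if_neg (by omega)]; ring
  · rw [if_neg hb.not_gt, if_pos (by omega)]; ring

lemma rel_12_12s (q : Set.Ioo (0 : ℝ) 1) (Y : Space) :
    A12 q Y * A12s q Y = A12s q Y * A12 q Y := by
  have hq := cq_ne_zero q
  ext F ⟨⟨a, b⟩, ⟨m, hm⟩⟩
  simp only [Module.End.mul_apply, A12s_apply, A12_apply, val_mem, hm, sub_add_cancel,
    add_sub_cancel_right]
  rcases lt_trichotomy b 0 with hb | rfl | hb
  · rw [if_neg (by omega), if_pos (by omega), if_pos (by omega), if_neg (by omega)]; ring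
  · simp
  · rw [if_pos (by omega), if_neg (by omega), if_neg (by omega), if_pos (by omega)]; ring

lemma rel_11_11s (q : Set.Ioo (0 : ℝ) 1) (Y : Space) :
    A11 q Y * A11s q Y = A12 q Y * A12s q Y - algebraMap ℂ _ (detVal Y) := by
  have hq := cq_ne_zero q
  ext F ⟨⟨a, b⟩, ⟨m, hm⟩⟩
  rw [LinearMap.sub_apply, Pi.sub_apply, A12_A12s_apply, Module.algebraMap_end_apply,
    Pi.smul_apply, smul_eq_mul, Module.End.mul_apply]
  rcases lt_or_ge 0 a with ha | ha
  · simp only [A11_apply, A11s_apply, val_mem, hm, ha, if_true, max_eq_left ha.le,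
      if_pos (show (0 : ℤ) ≤ a - 1 by omega), sub_add_cancel]
    ring
  · by_cases hm' : m - 1 ∈ Grid Y
    · simp only [A11_apply, A11s_apply, val_mem, hm, hm', ha.not_gt, if_false, max_eq_right ha,
        if_neg (show ¬ (0 : ℤ) ≤ a - 1 by omega), sub_add_cancel, zero_add]
      rw [zpow_neg]
      field_simp
    · simp only [A11_apply, val_notMem _ _ _ hm', ha.not_gt, if_false, max_eq_right ha, zero_add,
        ← sub_mul, grid_sub_one q hm hm']
      simp

lemma rel_11s_11 (q : Set.Ioo (0 : ℝ) 1) (Y : Space) :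
    A11s q Y * A11 q Y =
      (cq q)⁻¹ ^ 2 • (A12 q Y * A12s q Y) - algebraMap ℂ _ (detVal Y) := by
  have hq := cq_ne_zero q
  ext F ⟨⟨a, b⟩, ⟨m, hm⟩⟩
  have hm' := grid_add_one hm
  rw [LinearMap.sub_apply, Pi.sub_apply, LinearMap.smul_apply, Pi.smul_apply, A12_A12s_apply,
    Module.algebraMap_end_apply, Pi.smul_apply, smul_eq_mul, smul_eq_mul, Module.End.mul_apply]
  rcases le_or_gt 0 a with ha | ha
  · simp only [A11_apply, A11s_apply, val_mem, hm, ha, if_true, max_eq_left ha,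
      if_pos (show (0 : ℤ) < a + 1 by omega), add_sub_cancel_right]
    rw [show -2 * (a + 1 + m) = -2 * (a + m) - 1 - 1 by ring, zpow_sub_one₀ hq, zpow_sub_one₀ hq]
    ring
  · simp only [A11_apply, A11s_apply, val_mem, hm, hm', ha.not_ge, if_false, max_eq_right ha.le,
      if_neg (show ¬ (0 : ℤ) < a + 1 by omega), add_sub_cancel_right, zero_add]
    rw [show -2 * (m + 1) = -2 * m - 1 - 1 by ring, zpow_sub_one₀ hq, zpow_sub_one₀ hq, zpow_neg]
    field_simp

lemma lift_rel {R : Type*} [Ring R] [Algebra ℂ R] (q : Set.Ioo (0 : ℝ) 1) (Y : Space)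
    (T B Bs Ts : R) (f : Gen → R) (f11 : f .t11 = T) (f12 : f .t12 = B)
    (f21 : f .t21 = -((cq q)⁻¹ • Bs)) (f22 : f .t22 = -Ts)
    (h1 : T * B = cq q • (B * T)) (h2 : T * Bs = cq q • (Bs * T))
    (h3 : B * Ts = cq q • (Ts * B)) (h4 : Bs * Ts = cq q • (Ts * Bs)) (h5 : B * Bs = Bs * B)
    (h6 : T * Ts = B * Bs - algebraMap ℂ R (detVal Y))
    (h7 : Ts * T = (cq q)⁻¹ ^ 2 • (B * Bs) - algebraMap ℂ R (detVal Y)) :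
    ∀ ⦃x y⦄, Rel q Y x y → FreeAlgebra.lift ℂ f x = FreeAlgebra.lift ℂ f y := by
  have hq := cq_ne_zero q
  intro x y h
  cases h <;> simp only [map_mul, map_smul, map_sub, AlgHom.commutes, FreeAlgebra.lift_ι_apply,
    f11, f12, f21, f22, neg_mul, mul_neg, neg_neg, smul_mul_assoc, mul_smul_comm, smul_neg]
  · exact h1
  · rw [h4, smul_comm]
  · rw [h2, smul_comm]
  · rw [h3]
  · rw [h5]
  · rw [h6, h7]
    (match_scalars <;> field_simp); all_goals ring
  · rw [h6]
    (match_scalars <;> field_simp); all_goals ring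

/-- The left action of `Pol(Y)_q` on the formal series, with `t₂₁ = -q⁻¹ t₁₂^*` and
`t₂₂ = -t₁₁^*`. -/
def act (q : Set.Ioo (0 : ℝ) 1) (Y : Space) : Pol q Y →ₐ[ℂ] Module.End ℂ (Dist Y) :=
  RingQuot.liftAlgHom ℂ ⟨FreeAlgebra.lift ℂ (genAct q Y),
    lift_rel q Y (A11 q Y) (A12 q Y) (A12s q Y) (A11s q Y) (genAct q Y) rfl rfl rfl rfl
      (rel_11_12 q Y) (rel_11_12s q Y) (rel_12_11s q Y) (rel_12s_11s q Y) (rel_12_12s q Y)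
      (rel_11_11s q Y) (rel_11s_11 q Y)⟩

/-- The series `1`: `ψ_{00} = 1` and all the other coefficients vanish. -/
def oneDist (Y : Space) : Dist Y := fun i => if i.1 = (0, 0) then 1 else 0

/-- The embedding of `Pol(Y)_q` into `D(Y)'_q`: the expansion of `p = p · 1`. -/
def emb (q : Set.Ioo (0 : ℝ) 1) (Y : Space) : Pol q Y →ₗ[ℂ] Dist Y :=
  (LinearMap.applyₗ (oneDist Y)) ∘ₗ (act q Y).toLinearMap

lemma emb_apply (q : Set.Ioo (0 : ℝ) 1) (Y : Space) (g : Gen) :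
    emb q Y (gen q Y g) = genAct q Y g (oneDist Y) := by
  simp [emb, act, gen]

/-- The series of `t₁₁`. -/
lemma emb_t11 (q : Set.Ioo (0 : ℝ) 1) (Y : Space) :
    emb q Y (gen q Y .t11) = fun i => if i.1 = (1, 0) then 1 else 0 := by
  rw [emb_apply]
  ext ⟨⟨a, b⟩, ⟨m, hm⟩⟩
  by_cases ha : 0 < a
  · simp [genAct, A11_apply, val_mem, hm, ha, oneDist, sub_eq_zero]
  · have h1 : a ≠ 1 := by omega
    have h2 : a - 1 ≠ 0 := by omega
    simp [genAct, A11_apply, val, ha, oneDist, h1, h2]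

/-- The series of `t₁₂`. -/
lemma emb_t12 (q : Set.Ioo (0 : ℝ) 1) (Y : Space) :
    emb q Y (gen q Y .t12) = fun i => if i.1 = (0, 1) then 1 else 0 := by
  rw [emb_apply]
  ext ⟨⟨a, b⟩, ⟨m, hm⟩⟩
  by_cases ha : a = 0
  · by_cases hb : b = 1
    · simp [genAct, A12_apply, val_mem, hm, ha, oneDist, hb]
    · have : b - 1 ≠ 0 := by omega
      simp [genAct, A12_apply, val_mem, hm, ha, oneDist, hb, this]
  · simp [genAct, A12_apply, val_mem, hm, ha, oneDist]

/-- The series of `t₂₁ = -q⁻¹ t₁₂^*`. -/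
lemma emb_t21 (q : Set.Ioo (0 : ℝ) 1) (Y : Space) :
    emb q Y (gen q Y .t21) = fun i => if i.1 = (0, -1) then -(cq q)⁻¹ else 0 := by
  rw [emb_apply]
  ext ⟨⟨a, b⟩, ⟨m, hm⟩⟩
  by_cases ha : a = 0
  · by_cases hb : b = -1
    · simp [genAct, A12s_apply, val_mem, hm, ha, oneDist, hb]
    · have : b + 1 ≠ 0 := by omega
      simp [genAct, A12s_apply, val_mem, hm, ha, oneDist, hb, this]
  · simp [genAct, A12s_apply, val_mem, hm, ha, oneDist]

/-- The series of `t₂₂ = -t₁₁^*`. -/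
lemma emb_t22 (q : Set.Ioo (0 : ℝ) 1) (Y : Space) :
    emb q Y (gen q Y .t22) = fun i => if i.1 = (-1, 0) then -1 else 0 := by
  rw [emb_apply]
  ext ⟨⟨a, b⟩, ⟨m, hm⟩⟩
  have hm' := grid_add_one hm
  by_cases ha : 0 ≤ a
  · have h1 : a ≠ -1 := by omega
    have h2 : a + 1 ≠ 0 := by omega
    simp [genAct, A11s_apply, val_mem, hm, ha, oneDist, h1, h2]
  · by_cases h1 : a = -1
    · by_cases hb : b = 0 <;>
        simp [genAct, A11s_apply, val_mem, hm', oneDist, h1, hb]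
    · have h2 : a + 1 ≠ 0 := by omega
      simp [genAct, A11s_apply, val_mem, hm', ha, oneDist, h1, h2]

/-- The product `F · f` of a distribution and a finite function: the terms
`t₁₁^i₁ t₁₂^i₂ ψ_{i₁ i₂ j₁ j₂}(x) t₁₂^{* j₂} t₁₁^{* j₁}` of the series `F` act on `f` by left
multiplication, and the results are added (for finite `f`, each coefficient of the sum receives
finitely many nonzero contributions). -/
def mulFin (q : Set.Ioo (0 : ℝ) 1) {Y : Space} (F f : Dist Y) : Dist Y := fun i =>
  ∑ᶠ d : ℤ × ℤ,
    act q Y (gen q Y .t11 ^ d.1.toNat * gen q Y .t12 ^ d.2.toNat)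
      (Afun (fun m => F (d, m))
        (act q Y (t12s q Y ^ (-d.2).toNat * t11s q Y ^ (-d.1).toNat) f)) i

/-- The involution of `D(Y)'_q`: the antilinear antimultiplicative map which sends
`t₁₁^i₁ t₁₂^i₂ ψ(x) t₁₂^{* j₂} t₁₁^{* j₁}` to
`t₁₁^j₁ t₁₂^j₂ (conj ψ)(x) t₁₂^{* i₂} t₁₁^{* i₁}`, termwise. -/
def conjDist {Y : Space} (F : Dist Y) : Dist Y := fun i =>
  starRingEnd ℂ (F ((-i.1.1, -i.1.2), i.2))

/-- The involution satisfies `t₁₁^* = -t₂₂`. -/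
lemma conjDist_emb_t11 (q : Set.Ioo (0 : ℝ) 1) (Y : Space) :
    conjDist (emb q Y (gen q Y .t11)) = emb q Y (t11s q Y) := by
  rw [t11s, map_neg, emb_t22, emb_t11]
  ext ⟨⟨a, b⟩, m⟩
  by_cases h : a = -1 ∧ b = 0
  · simp [conjDist, h]
  · have h' : ¬ (-a = 1 ∧ b = 0) := by omega
    simp [conjDist, h, h']

/-- The involution satisfies `t₁₂^* = -q t₂₁`. -/
lemma conjDist_emb_t12 (q : Set.Ioo (0 : ℝ) 1) (Y : Space) :
    conjDist (emb q Y (gen q Y .t12)) = emb q Y (t12s q Y) := by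
  rw [t12s, map_neg, map_smul, emb_t21, emb_t12]
  have hq := cq_ne_zero q
  ext ⟨⟨a, b⟩, m⟩
  by_cases h : a = 0 ∧ b = -1
  · simp [conjDist, h, hq]
  · have h' : ¬ (a = 0 ∧ -b = 1) := by omega
    simp [conjDist, h, h']

/-- The invariant integral `(1 - q²) ∑ ψ_{00}(q^(-2m)) q^(-2m)`, for `F` such that `ψ_{00}`
has finite support. -/
def integral (q : Set.Ioo (0 : ℝ) 1) {Y : Space} (F : Dist Y) : ℂ :=
  (1 - cq q ^ 2) * ∑ᶠ m : Grid Y, F ((0, 0), m) * cq q ^ (-2 * (m : ℤ))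

/-- The space `D(Y₁ × Y₂)'_q` of distributions on the product: formal series whose coefficients
are functions on the product of the two progressions. -/
abbrev Dist2 (Y₁ Y₂ : Space) : Type := Idx Y₁ → Idx Y₂ → ℂ

/-- `Pol(Y₁ × Y₂)_q`, the tensor product of the opposite of `Pol(Y₁)_q` and `Pol(Y₂)_q`. -/
abbrev Pol2 (q : Set.Ioo (0 : ℝ) 1) (Y₁ Y₂ : Space) : Type := (Pol q Y₁)ᵐᵒᵖ ⊗[ℂ] Pol q Y₂

/-- `F₁ ⊗ F₂` as a distribution on the product. -/
def extProd (Y₁ Y₂ : Space) : Dist Y₁ →ₗ[ℂ] Dist Y₂ →ₗ[ℂ] Dist2 Y₁ Y₂ :=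
  LinearMap.mk₂ ℂ (fun F₁ F₂ i₁ i₂ => F₁ i₁ * F₂ i₂)
    (fun _ _ _ => by ext; simp [add_mul]) (fun _ _ _ => by ext; simp [mul_assoc])
    (fun _ _ _ => by ext; simp [mul_add]) (fun _ _ _ => by ext; simp [mul_left_comm])

/-- The embedding of `Pol(Y₁ × Y₂)_q` into `D(Y₁ × Y₂)'_q`. -/
def emb2 (q : Set.Ioo (0 : ℝ) 1) (Y₁ Y₂ : Space) : Pol2 q Y₁ Y₂ →ₗ[ℂ] Dist2 Y₁ Y₂ :=
  TensorProduct.lift ((extProd Y₁ Y₂).compl₁₂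
    (emb q Y₁ ∘ₗ (MulOpposite.opLinearEquiv ℂ).symm.toLinearMap) (emb q Y₂))

/-- The kernel `t_{ij} = t_{ij} ⊗ 1`. -/
def t (q : Set.Ioo (0 : ℝ) 1) (Y₁ Y₂ : Space) (g : Gen) : Pol2 q Y₁ Y₂ :=
  MulOpposite.op (gen q Y₁ g) ⊗ₜ[ℂ] 1

/-- The kernel `τ_{ij} = 1 ⊗ t_{ij}`. -/
def τ (q : Set.Ioo (0 : ℝ) 1) (Y₁ Y₂ : Space) (g : Gen) : Pol2 q Y₁ Y₂ :=
  1 ⊗ₜ[ℂ] gen q Y₂ g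

/-- The partial integral `∫ {K · 1 ⊗ f} dν₂ ∈ D(Y₁)'_q` of a kernel `K ∈ D(Y₁ × Y₂)'_q` against
a finite function `f` on `Y₂`. -/
def partialInt (q : Set.Ioo (0 : ℝ) 1) {Y₁ Y₂ : Space} (K : Dist2 Y₁ Y₂) (f : Dist Y₂) :
    Dist Y₁ := fun i => integral q (mulFin q (K i) f)

/-- The property that determines the antilinear map `#` of the space of kernels: for all kernels
`K` and finite functions `f`, `∫ {K^# · 1 ⊗ f} dν₂ = (∫ {K · 1 ⊗ f^*} dν₂)^*`. -/
def IsSharp (q : Set.Ioo (0 : ℝ) 1) {Y₁ Y₂ : Space}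
    (s : Dist2 Y₁ Y₂ →ₛₗ[starRingEnd ℂ] Dist2 Y₁ Y₂) : Prop :=
  ∀ (K : Dist2 Y₁ Y₂) (f : Dist Y₂), IsFin f →
    partialInt q (s K) f = conjDist (partialInt q K (conjDist f))

end QKernel

end

/-! `Pol(Y)_q` is `ℤ²`-graded, with `t₁₁` and `t₁₂` in degrees `(1, 0)` and `(0, 1)` and `*`
negating degrees, so the degree zero part of `F f` only involves the coefficients of `F` and `f`
in opposite degrees. These are taken at the same point of the progression: with `i^*` the index
of the adjoint monomial, `∫ F f dν = ∑ w(i) F(i) f(i^*)` for explicit real nonzero weights `w`.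
As `w(i^*) = q^(2a) w(i)` in degree `(a, b)`, the integral is a twisted trace: the complex
conjugate of `∫ F f^* dν` is `∫ σ(F^*) f dν`, where `σ` multiplies the part of degree `(a, b)` by
`q^(2a)`. Hence `(F₁ ⊗ F₂)^# = F₁^* ⊗ σ(F₂^*)`, and `#` is unique because the pairing is
nondegenerate. The factor `q⁻²` in `τ₁₁^#` comes from `σ` in degree `(-1, 0)`. -/

noncomputable section

namespace QKernel

open Finset

lemma finsum_comp_eq_of_support_subset_range {α β M : Type*} [AddCommMonoid M] {e : α → β}
    (he : Function.Injective e) {g : β → M} (hg : Function.support g ⊆ Set.range e) :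
    ∑ᶠ a, g (e a) = ∑ᶠ b, g b := by
  rw [← finsum_mem_range he, finsum_mem_def, Set.indicator_eq_self.2 hg]

section Pairing

variable (q : Set.Ioo (0 : ℝ) 1) {Y : Space}

lemma conj_cq : starRingEnd ℂ (cq q) = cq q := Complex.conj_ofReal _

lemma one_sub_cq_sq_ne_zero : 1 - cq q ^ 2 ≠ 0 := by
  have h : (q : ℝ) ^ 2 ≠ 1 := (pow_lt_one₀ q.2.1.le q.2.2 two_ne_zero).ne
  rw [sub_ne_zero, cq]
  exact_mod_cast h.symm

lemma grid_add_nat {m : ℤ} (hm : m ∈ Grid Y) (n : ℕ) : m + n ∈ Grid Y := by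
  induction n with
  | zero => simpa using hm
  | succ n ih => simpa [add_assoc] using grid_add_one ih

lemma act_gen (Y : Space) (g : Gen) : act q Y (gen q Y g) = genAct q Y g := by
  simp [act, gen]

lemma act_t11s (Y : Space) : act q Y (t11s q Y) = A11s q Y := by
  simp [t11s, act_gen, genAct]

lemma act_t12s (Y : Space) : act q Y (t12s q Y) = A12s q Y := by
  simp [t12s, act_gen, genAct, cq_ne_zero q]

lemma val_A11 (F : Dist Y) {a : ℤ} (ha : a ≤ 0) (b m : ℤ) :
    val (A11 q Y F) a b m =
      cq q ^ |b| * (cq q ^ (-2 * m) - detVal Y) * val F (a - 1) b (m - 1) := by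
  by_cases hm : m ∈ Grid Y
  · rw [val_mem _ _ _ hm, A11_apply, if_neg ha.not_gt]
  · have hm' : m - 1 ∉ Grid Y := fun h => hm (by simpa using grid_add_one h)
    rw [val_notMem _ _ _ hm, val_notMem _ _ _ hm', mul_zero]

lemma val_A11s (F : Dist Y) {a : ℤ} (ha : 0 ≤ a) (b m : ℤ) :
    val (A11s q Y F) a b m =
      (cq q ^ (-2 * (a + 1 + m)) - detVal Y) * val F (a + 1) b m := by
  by_cases hm : m ∈ Grid Y
  · rw [val_mem _ _ _ hm, A11s_apply, if_pos ha]
  · simp only [val_notMem _ _ _ hm, mul_zero]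

lemma val_A12 (F : Dist Y) (a : ℤ) {b : ℤ} (hb : b ≤ 0) (m : ℤ) :
    val (A12 q Y F) a b m = cq q ^ (-max a 0) * cq q ^ (-2 * m) * val F a (b - 1) m := by
  by_cases hm : m ∈ Grid Y
  · rw [val_mem _ _ _ hm, A12_apply, if_neg hb.not_gt]
  · simp only [val_notMem _ _ _ hm, mul_zero]

lemma val_A12s (F : Dist Y) (a : ℤ) {b : ℤ} (hb : 0 ≤ b) (m : ℤ) :
    val (A12s q Y F) a b m = cq q ^ (-max a 0) * cq q ^ (-2 * m) * val F a (b + 1) m := by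
  by_cases hm : m ∈ Grid Y
  · rw [val_mem _ _ _ hm, A12s_apply, if_neg hb.not_gt]
  · simp only [val_notMem _ _ _ hm, mul_zero]

lemma val_Afun (F G : Dist Y) {a : ℤ} (ha : a ≤ 0) (b : ℤ) (d : ℤ × ℤ) (m : ℤ) :
    val (Afun (fun m => F (d, m)) G) a b m = val F d.1 d.2 m * val G a b m := by
  by_cases hm : m ∈ Grid Y
  · simp [val_mem _ _ _ hm, Afun, hm, ha]
  · simp only [val_notMem _ _ _ hm, mul_zero]

/-- The value of `t₁₁^{* n} t₁₁^n = ∏ (q^(-2k) x - detVal Y)`, `1 ≤ k ≤ n`, at `x = q^(-2m)`. It is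
also the value of `t₁₁^n t₁₁^{* n}` at `x = q^(-2(m + n))`. -/
def t11NormSq (Y : Space) (n : ℕ) (m : ℤ) : ℂ :=
  ∏ k ∈ range n, (cq q ^ (-2 * (m + k + 1)) - detVal Y)

lemma t11NormSq_zero (Y : Space) (m : ℤ) : t11NormSq q Y 0 m = 1 := prod_range_zero _

lemma t11NormSq_succ (Y : Space) (n : ℕ) (m : ℤ) :
    t11NormSq q Y (n + 1) m = t11NormSq q Y n m * (cq q ^ (-2 * (m + n + 1)) - detVal Y) :=
  prod_range_succ _ n

lemma conj_t11NormSq (Y : Space) (n : ℕ) (m : ℤ) :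
    starRingEnd ℂ (t11NormSq q Y n m) = t11NormSq q Y n m := by
  have h : starRingEnd ℂ (detVal Y) = detVal Y := by cases Y <;> simp [detVal]
  simp only [t11NormSq, map_prod, map_sub, map_zpow₀, conj_cq, h]

lemma t11NormSq_ne_zero (n : ℕ) {m : ℤ} (hm : m ∈ Grid Y) : t11NormSq q Y n m ≠ 0 := by
  refine prod_ne_zero_iff.2 fun k _ => ?_
  cases Y
  · have hm : 0 ≤ m := hm
    have h : (q : ℝ) ^ (-2 * (m + k + 1)) ≠ 1 :=
      (one_lt_zpow_of_neg₀ q.2.1 q.2.2 (by omega)).ne'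
    simp only [detVal, sub_ne_zero, cq]
    exact_mod_cast h
  · simpa [detVal] using zpow_ne_zero _ (cq_ne_zero q)

lemma val_A11_pow (F : Dist Y) (n : ℕ) {a : ℤ} (ha : a ≤ 0) (b m : ℤ) :
    val ((A11 q Y ^ n) F) a b (m + n) =
      (cq q ^ |b|) ^ n * t11NormSq q Y n m * val F (a - n) b m := by
  induction n generalizing a with
  | zero => simp [t11NormSq_zero]
  | succ n ih =>
    rw [pow_succ', Module.End.mul_apply, val_A11 q _ ha, t11NormSq_succ]
    push_cast
    rw [← add_assoc, add_sub_cancel_right, ih (by omega), sub_sub, add_comm 1 (n : ℤ)]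
    ring

lemma val_A11s_pow (F : Dist Y) (n : ℕ) {a : ℤ} (ha : 0 ≤ a) (b m : ℤ) :
    val ((A11s q Y ^ n) F) a b m = t11NormSq q Y n (a + m) * val F (a + n) b m := by
  induction n generalizing F with
  | zero => simp [t11NormSq_zero]
  | succ n ih =>
    rw [pow_succ, Module.End.mul_apply, ih, val_A11s q _ (by omega), t11NormSq_succ,
      show a + n + 1 + m = a + m + n + 1 by ring]
    push_cast
    rw [← add_assoc a (n : ℤ) 1, mul_assoc]

lemma val_A12_pow (F : Dist Y) (n : ℕ) (a : ℤ) {b : ℤ} (hb : b ≤ 0) (m : ℤ) :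
    val ((A12 q Y ^ n) F) a b m =
      (cq q ^ (-max a 0) * cq q ^ (-2 * m)) ^ n * val F a (b - n) m := by
  induction n generalizing F with
  | zero => simp
  | succ n ih =>
    rw [pow_succ, Module.End.mul_apply, ih, val_A12 q _ a (by omega), pow_succ, sub_sub,
      ← mul_assoc]
    push_cast
    rfl

lemma val_A12s_pow (F : Dist Y) (n : ℕ) (a : ℤ) {b : ℤ} (hb : 0 ≤ b) (m : ℤ) :
    val ((A12s q Y ^ n) F) a b m =
      (cq q ^ (-max a 0) * cq q ^ (-2 * m)) ^ n * val F a (b + n) m := by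
  induction n generalizing F with
  | zero => simp
  | succ n ih =>
    rw [pow_succ, Module.End.mul_apply, ih, val_A12s q _ a (by omega), pow_succ, add_assoc,
      ← mul_assoc]
    push_cast
    rfl

/-- The contribution to the product `F · f` of the term of degree `d = (i₁ - j₁, i₂ - j₂)` of the
series `F`. -/
def mulTerm (F f : Dist Y) (d : ℤ × ℤ) : Dist Y :=
  act q Y (gen q Y .t11 ^ d.1.toNat * gen q Y .t12 ^ d.2.toNat)
    (Afun (fun m => F (d, m))
      (act q Y (t12s q Y ^ (-d.2).toNat * t11s q Y ^ (-d.1).toNat) f))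

lemma mulTerm_eq (F f : Dist Y) (d : ℤ × ℤ) :
    mulTerm q F f d = (A11 q Y ^ d.1.toNat) ((A12 q Y ^ d.2.toNat)
      (Afun (fun m => F (d, m)) ((A12s q Y ^ (-d.2).toNat) ((A11s q Y ^ (-d.1).toNat) f)))) := by
  simp [mulTerm, act_gen, act_t11s, act_t12s, genAct]

lemma val_A12_pow_Afun_A12s_pow (F G : Dist Y) (d : ℤ × ℤ) {a : ℤ} (ha : a ≤ 0) (m : ℤ) :
    val ((A12 q Y ^ d.2.toNat) (Afun (fun m => F (d, m)) ((A12s q Y ^ (-d.2).toNat) G))) a 0 m =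
      (cq q ^ (-2 * m)) ^ d.2.natAbs * val F d.1 d.2 m * val G a (-d.2) m := by
  obtain ⟨d, b⟩ := d
  obtain ⟨n, rfl | rfl⟩ := b.eq_nat_or_neg
  · simp [val_A12_pow, val_Afun _ _ ha, ha, mul_assoc]
  · simp [val_A12s_pow, val_Afun _ _ ha, ha, mul_left_comm, mul_assoc]

lemma val_mulTerm (F f : Dist Y) (d : ℤ × ℤ) (m : ℤ) :
    val (mulTerm q F f d) 0 0 (m + d.1.toNat) =
      t11NormSq q Y d.1.natAbs m * (cq q ^ (-2 * m)) ^ d.2.natAbs *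
        val F d.1 d.2 m * val f (-d.1) (-d.2) m := by
  rw [mulTerm_eq, val_A11_pow q _ _ le_rfl, val_A12_pow_Afun_A12s_pow q _ _ _ (by omega)]
  obtain ⟨a, b⟩ := d
  obtain ⟨n, rfl | rfl⟩ := a.eq_nat_or_neg
  · simp [mul_assoc]
  · simp [val_A11s_pow, t11NormSq_zero, mul_assoc, mul_left_comm]

/-- The index `i^*` of the adjoint of the monomial with index `i`: the degree changes sign, and the
point stays because `x^* = x`. -/
def starIdx (i : Idx Y) : Idx Y := (-i.1, i.2)

lemma starIdx_involutive : Function.Involutive (starIdx (Y := Y)) := fun i => by simp [starIdx]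

lemma conjDist_apply (F : Dist Y) (i : Idx Y) :
    conjDist F i = starRingEnd ℂ (F (starIdx i)) := rfl

lemma IsFin.conjDist {f : Dist Y} (hf : IsFin f) : IsFin (conjDist f) := by
  refine (hf.image starIdx).subset fun i hi => ⟨starIdx i, fun h => hi ?_, starIdx_involutive i⟩
  rw [conjDist_apply, h, map_zero]

/-- The place in `(F · f)_{00}` reached by the coefficient of `F` at `i = ((a, b), m)`: the point
`x = q^(-2(m + max a 0))`, together with the degree `(a, b)` of the term of `F`. The shift of the
point comes from `t₁₁^a ψ(x) = ψ(q^(2a) x) t₁₁^a`. -/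
def mulIdx (i : Idx Y) : Grid Y × (ℤ × ℤ) := (⟨i.2 + i.1.1.toNat, grid_add_nat i.2.2 _⟩, i.1)

lemma mulIdx_injective : Function.Injective (mulIdx (Y := Y)) := by
  rintro ⟨d, m, hm⟩ ⟨d', m', hm'⟩ h
  obtain ⟨h, rfl⟩ : m + d.1.toNat = m' + d'.1.toNat ∧ d = d' := by simpa [mulIdx] using h
  obtain rfl : m = m' := by omega
  rfl

lemma mulTerm_mulIdx (F f : Dist Y) (i : Idx Y) :
    mulTerm q F f i.1 ((0, 0), (mulIdx i).1) =
      t11NormSq q Y i.1.1.natAbs i.2 * (cq q ^ (-2 * (i.2 : ℤ))) ^ i.1.2.natAbs *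
        F i * f (starIdx i) := by
  obtain ⟨d, m, hm⟩ := i
  have h := val_mulTerm q F f d m
  rwa [val_mem F _ _ hm, val_mem f _ _ hm, val_mem _ _ _ (grid_add_nat hm _)] at h

lemma mulTerm_eq_zero_of_notMem_range (F f : Dist Y) {p : Grid Y × (ℤ × ℤ)}
    (hp : p ∉ Set.range (mulIdx (Y := Y))) : mulTerm q F f p.2 ((0, 0), p.1) = 0 := by
  obtain ⟨⟨n, hn⟩, d⟩ := p
  have hm : n - d.1.toNat ∉ Grid Y := fun h => hp ⟨(d, ⟨_, h⟩), by simp [mulIdx]⟩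
  have h := val_mulTerm q F f d (n - d.1.toNat)
  rwa [val_notMem _ _ _ hm, mul_zero, zero_mul, sub_add_cancel, val_mem _ _ _ hn] at h

/-- The weights of the pairing `(F, f) ↦ ∫ F f dν` in the coefficients of `F` and `f`; see
`integral_mulFin`. -/
def pairWeight (i : Idx Y) : ℂ :=
  (1 - cq q ^ 2) * (t11NormSq q Y i.1.1.natAbs i.2 * (cq q ^ (-2 * (i.2 : ℤ))) ^ i.1.2.natAbs *
    cq q ^ (-2 * ((i.2 : ℤ) + i.1.1.toNat)))

lemma pairWeight_ne_zero (i : Idx Y) : pairWeight q i ≠ 0 := by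
  have hq (n : ℤ) : cq q ^ n ≠ 0 := zpow_ne_zero n (cq_ne_zero q)
  exact mul_ne_zero (one_sub_cq_sq_ne_zero q)
    (mul_ne_zero (mul_ne_zero (t11NormSq_ne_zero q _ i.2.2) (pow_ne_zero _ (hq _))) (hq _))

lemma conj_pairWeight (i : Idx Y) : starRingEnd ℂ (pairWeight q i) = pairWeight q i := by
  simp only [pairWeight, map_mul, map_sub, map_one, map_pow, map_zpow₀, conj_cq, conj_t11NormSq]

lemma pairWeight_starIdx (i : Idx Y) :
    pairWeight q (starIdx i) = cq q ^ (2 * i.1.1) * pairWeight q i := by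
  obtain ⟨⟨a, b⟩, m⟩ := i
  have h : cq q ^ (-2 * ((m : ℤ) + (-a).toNat)) =
      cq q ^ (2 * a) * cq q ^ (-2 * ((m : ℤ) + a.toNat)) := by
    rw [← zpow_add₀ (cq_ne_zero q)]
    congr 1
    omega
  simp only [pairWeight, starIdx, Prod.neg_mk, Int.natAbs_neg, h]
  ring

theorem integral_mulFin (F : Dist Y) {f : Dist Y} (hf : IsFin f) :
    integral q (mulFin q F f) = ∑ᶠ i, pairWeight q i * F i * f (starIdx i) := by
  set g : Grid Y × (ℤ × ℤ) → ℂ := fun p =>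
    mulTerm q F f p.2 ((0, 0), p.1) * cq q ^ (-2 * (p.1 : ℤ)) with hg
  have g_mulIdx (i : Idx Y) :
      (1 - cq q ^ 2) * g (mulIdx i) = pairWeight q i * F i * f (starIdx i) := by
    change _ * (mulTerm q F f i.1 _ * cq q ^ (-2 * ((i.2 : ℤ) + i.1.1.toNat))) = _
    rw [mulTerm_mulIdx, pairWeight]
    ring
  have g_support : Function.support g ⊆ Set.range mulIdx := fun p hp => by
    contrapose! hp
    simp [hg, mulTerm_eq_zero_of_notMem_range q F f hp]
  have g_finite : (Function.support g).Finite := by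
    refine (hf.image (mulIdx ∘ starIdx)).subset fun p hp => ?_
    obtain ⟨i, rfl⟩ := g_support hp
    refine ⟨starIdx i, fun h => hp ?_, congrArg mulIdx (starIdx_involutive i)⟩
    simpa [h, one_sub_cq_sq_ne_zero q] using g_mulIdx i
  calc integral q (mulFin q F f)
      = (1 - cq q ^ 2) * ∑ᶠ m, ∑ᶠ d, g (m, d) :=
        congrArg _ (finsum_congr fun m => finsum_mul _ _)
    _ = (1 - cq q ^ 2) * ∑ᶠ i, g (mulIdx i) := by
        rw [← finsum_curry g g_finite,
          finsum_comp_eq_of_support_subset_range mulIdx_injective g_support]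
    _ = ∑ᶠ i, pairWeight q i * F i * f (starIdx i) := by
        rw [mul_finsum]
        exact finsum_congr g_mulIdx

lemma isFin_single (i : Idx Y) (c : ℂ) : IsFin (Pi.single i c) :=
  (Set.finite_singleton i).subset Pi.support_single_subset

lemma integral_mulFin_single (F : Dist Y) (i : Idx Y) :
    integral q (mulFin q F (Pi.single (starIdx i) 1)) = pairWeight q i * F i := by
  rw [integral_mulFin q F (isFin_single _ _), finsum_eq_single _ i]
  · simp
  · intro j hj
    simp [Pi.single_eq_of_ne (starIdx_involutive.injective.ne hj)]

theorem eq_of_forall_integral_mulFin_eq {F G : Dist Y}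
    (h : ∀ f, IsFin f → integral q (mulFin q F f) = integral q (mulFin q G f)) : F = G := by
  ext i
  have hi := h (Pi.single (starIdx i) 1) (isFin_single _ _)
  rw [integral_mulFin_single, integral_mulFin_single] at hi
  exact mul_left_cancel₀ (pairWeight_ne_zero q i) hi

/-- The modular automorphism `σ` of the invariant integral, `∫ f g dν = ∫ σ(g) f dν`: it multiplies
the coefficients of degree `(a, b)` by `q^(2a)`. -/
def modularAut : Dist Y →ₗ[ℂ] Dist Y where
  toFun F := fun i => cq q ^ (2 * i.1.1) * F i
  map_add' F G := by
    ext i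
    simp only [Pi.add_apply, mul_add]
  map_smul' c F := by
    ext i
    simp only [Pi.smul_apply, smul_eq_mul, RingHom.id_apply, mul_left_comm]

lemma modularAut_apply (F : Dist Y) (i : Idx Y) :
    modularAut q F i = cq q ^ (2 * i.1.1) * F i := rfl

lemma modularAut_eq_smul {n : ℤ} {F : Dist Y} (hF : ∀ i, i.1.1 ≠ n → F i = 0) :
    modularAut q F = cq q ^ (2 * n) • F := by
  ext i
  by_cases hi : i.1.1 = n
  · rw [modularAut_apply, hi, Pi.smul_apply, smul_eq_mul]
  · rw [modularAut_apply, Pi.smul_apply, hF i hi, mul_zero, smul_zero]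

theorem integral_mulFin_modularAut_conjDist (F : Dist Y) {f : Dist Y} (hf : IsFin f) :
    integral q (mulFin q (modularAut q (conjDist F)) f) =
      starRingEnd ℂ (integral q (mulFin q F (conjDist f))) := by
  rw [integral_mulFin q _ hf, integral_mulFin q _ hf.conjDist]
  calc ∑ᶠ i, pairWeight q i * modularAut q (conjDist F) i * f (starIdx i)
      = ∑ᶠ i, starRingEnd ℂ (pairWeight q i * F i * conjDist f (starIdx i)) := by
        refine finsum_eq_of_bijective starIdx starIdx_involutive.bijective fun i => ?_
        simp only [map_mul, map_zpow₀, conj_cq, conj_pairWeight, pairWeight_starIdx,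
          modularAut_apply, conjDist_apply, starIdx_involutive _, Complex.conj_conj]
        ring
    _ = starRingEnd ℂ (∑ᶠ i, pairWeight q i * F i * conjDist f (starIdx i)) :=
        ((starRingAut (R := ℂ)).toAddEquiv.map_finsum _).symm

end Pairing

section Kernels

variable (q : Set.Ioo (0 : ℝ) 1) {Y Y₁ Y₂ : Space}

/-- The involution `#` of the space of kernels, `(F₁ ⊗ F₂)^# = F₁^* ⊗ σ(F₂^*)`. -/
def sharp : Dist2 Y₁ Y₂ →ₛₗ[starRingEnd ℂ] Dist2 Y₁ Y₂ where
  toFun K := fun i => modularAut q (conjDist (K (starIdx i)))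
  map_add' K L := by
    ext i j
    simp only [modularAut_apply, conjDist_apply, Pi.add_apply, map_add, mul_add]
  map_smul' c K := by
    ext i j
    simp only [modularAut_apply, conjDist_apply, Pi.smul_apply, smul_eq_mul, map_mul,
      mul_left_comm]

theorem isSharp_sharp : IsSharp q (sharp q : Dist2 Y₁ Y₂ →ₛₗ[starRingEnd ℂ] Dist2 Y₁ Y₂) :=
  fun K _ hf => funext fun i => integral_mulFin_modularAut_conjDist q (K (starIdx i)) hf

variable {q} in
theorem IsSharp.eq_sharp {s : Dist2 Y₁ Y₂ →ₛₗ[starRingEnd ℂ] Dist2 Y₁ Y₂} (hs : IsSharp q s) :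
    s = sharp q := by
  ext K i : 2
  refine eq_of_forall_integral_mulFin_eq q fun f hf => ?_
  exact congrFun ((hs K f hf).trans (isSharp_sharp q K f hf).symm) i

lemma sharp_extProd (F₁ : Dist Y₁) (F₂ : Dist Y₂) :
    sharp q (extProd Y₁ Y₂ F₁ F₂) =
      extProd Y₁ Y₂ (conjDist F₁) (modularAut q (conjDist F₂)) := by
  ext i j
  change _ * starRingEnd ℂ (F₁ (starIdx i) * F₂ (starIdx j)) =
    starRingEnd ℂ (F₁ (starIdx i)) * (_ * starRingEnd ℂ (F₂ (starIdx j)))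
  rw [map_mul, mul_left_comm]

lemma conjDist_oneDist : conjDist (oneDist Y) = oneDist Y := by
  ext ⟨⟨a, b⟩, m⟩
  simp [conjDist, oneDist, apply_ite (starRingEnd ℂ)]

lemma modularAut_oneDist : modularAut q (oneDist Y) = oneDist Y := by
  unfold oneDist
  rw [modularAut_eq_smul q (n := 0) fun i hi => if_neg fun h => hi (by simp [h])]
  simp

lemma modularAut_emb_t12 :
    modularAut q (emb q Y (gen q Y .t12)) = emb q Y (gen q Y .t12) := by
  rw [emb_t12, modularAut_eq_smul q (n := 0) fun i hi => if_neg fun h => hi (by simp [h])]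
  simp

lemma modularAut_emb_t22 :
    modularAut q (emb q Y (gen q Y .t22)) = (cq q ^ 2)⁻¹ • emb q Y (gen q Y .t22) := by
  rw [emb_t22, modularAut_eq_smul q (n := -1) fun i hi => if_neg fun h => hi (by simp [h])]
  congr 1

lemma conjDist_emb_t21 :
    conjDist (emb q Y (gen q Y .t21)) = -(cq q)⁻¹ • emb q Y (gen q Y .t12) := by
  rw [emb_t21, emb_t12]
  ext ⟨⟨a, b⟩, m⟩
  by_cases h : a = 0 ∧ b = 1 <;> simp [conjDist, h, conj_cq]

lemma emb2_t (g : Gen) :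
    emb2 q Y₁ Y₂ (t q Y₁ Y₂ g) = extProd Y₁ Y₂ (emb q Y₁ (gen q Y₁ g)) (oneDist Y₂) := by
  simp [emb2, t, emb]

lemma emb2_τ (g : Gen) :
    emb2 q Y₁ Y₂ (τ q Y₁ Y₂ g) = extProd Y₁ Y₂ (oneDist Y₁) (emb q Y₂ (gen q Y₂ g)) := by
  simp [emb2, τ, emb]

lemma sharp_emb2_t (g : Gen) :
    sharp q (emb2 q Y₁ Y₂ (t q Y₁ Y₂ g)) =
      extProd Y₁ Y₂ (conjDist (emb q Y₁ (gen q Y₁ g))) (oneDist Y₂) := by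
  rw [emb2_t, sharp_extProd, conjDist_oneDist, modularAut_oneDist]

lemma sharp_emb2_τ (g : Gen) :
    sharp q (emb2 q Y₁ Y₂ (τ q Y₁ Y₂ g)) =
      extProd Y₁ Y₂ (oneDist Y₁) (modularAut q (conjDist (emb q Y₂ (gen q Y₂ g)))) := by
  rw [emb2_τ, sharp_extProd, conjDist_oneDist]

end Kernels

end QKernel

end

open QKernel in
theorem proposition6p3 (q : Set.Ioo (0 : ℝ) 1) (Y₁ Y₂ : Space) :
    (∃! s : Dist2 Y₁ Y₂ →ₛₗ[starRingEnd ℂ] Dist2 Y₁ Y₂, IsSharp q s) ∧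
    ∀ s : Dist2 Y₁ Y₂ →ₛₗ[starRingEnd ℂ] Dist2 Y₁ Y₂, IsSharp q s →
      s (emb2 q Y₁ Y₂ (t q Y₁ Y₂ .t11)) = emb2 q Y₁ Y₂ (-t q Y₁ Y₂ .t22) ∧
      s (emb2 q Y₁ Y₂ (t q Y₁ Y₂ .t21)) = emb2 q Y₁ Y₂ (-(cq q)⁻¹ • t q Y₁ Y₂ .t12) ∧
      s (emb2 q Y₁ Y₂ (τ q Y₁ Y₂ .t11)) = emb2 q Y₁ Y₂ (-(cq q ^ 2)⁻¹ • τ q Y₁ Y₂ .t22) ∧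
      s (emb2 q Y₁ Y₂ (τ q Y₁ Y₂ .t21)) = emb2 q Y₁ Y₂ (-(cq q)⁻¹ • τ q Y₁ Y₂ .t12) := by
  refine ⟨⟨sharp q, isSharp_sharp q, fun s hs => hs.eq_sharp⟩, fun s hs => ?_⟩
  obtain rfl := hs.eq_sharp
  refine ⟨?_, ?_, ?_, ?_⟩
  · rw [sharp_emb2_t, conjDist_emb_t11, t11s, map_neg, map_neg, LinearMap.neg_apply, ← emb2_t]
    exact (map_neg (emb2 q Y₁ Y₂) _).symm
  · rw [sharp_emb2_t, conjDist_emb_t21, map_smul, map_smul, emb2_t, LinearMap.smul_apply]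
  · rw [sharp_emb2_τ, conjDist_emb_t11, t11s, map_neg, map_neg, modularAut_emb_t22, map_neg,
      map_smul, map_smul, emb2_τ, neg_smul]
  · rw [sharp_emb2_τ, conjDist_emb_t21, map_smul, modularAut_emb_t12, map_smul, map_smul, emb2_τ]
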